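/- Let $V$ be the finite set of users of a directed social network other than a distinguished user $u_0$; an arc $u\to v$ means that $v$ follows $u$, so that tweets of $u$ reach $v$. For $v\in V$, $u\in V\cup\{u_0\}$ and $S\subseteq V\cup\{u_0\}$ let $p_v(u,S)\in[0,1]$ be the probability that $v$ retweets a message when it receives it from $u$, given that the users in $S$ have already tried in vain. Assume that the model is an order-independent decreasing cascade model: for every $v$, on sets of potential in-neighbours of $v$ (its in-neighbours in the network, and $u_0$), $p_v(u,S)\ge p_v(u,T)$ whenever $S\subseteq T\not\ni u$, and the probability $1-\prod_i\bigl(1-p_v(u_i,S\cup\{u_1,\dots,u_{i-1}\})\bigr)$ that one of the distinct users $u_1,\dots,u_k\notin S$, trying in this order, succeeds does not depend on their order. For each $v\in V$ let the Bernoulli random variable $R_v$ (with an arbitrary joint law) indicate whether $v$ follows $u_0$ back when $u_0$ follows $v$. If $u_0$ follows the users in $B\subseteq V$, then $u_0$'s followers are the $v\in B$ with $R_v=1$. Given these, a tweet of $u_0$ starts the following cascade. At time $0$ only $u_0$ is active. Each user that becomes active at time $t$ makes at time $t+1$ one attempt on each of its inactive followers, the attempts within a round being ordered arbitrarily; an attempt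 of $u$ on $v$ succeeds with probability $p_v(u,S)$, where $S$ is the set of those that have attempted on $v$ before, and then $v$ becomes active. Attempts on different users in one round are independent. Let $\varphi(B)\subseteq V$ be the set of users other than $u_0$ that are active at the end of the cascade (the retweeters). Fix $K\in\mathbb N$, and consider the dynamic problem: knowing the values $R_v$, maximize $\mathbb E|\varphi(B)|$ (expectation over the cascade) subject to $|B|\le K$ and $R_v=1$ for all $v\in B$. The greedy algorithm starts from $B=\emptyset$ and in each of $K$ steps adds to $B$ a not yet selected user $v$ with $R_v=1$ that maximizes the marginal gain $\mathbb E|\varphi(B\cup\{v\})|-\mathbb E|\varphi(B)|$ (ties broken arbitrarily), as long as there is such a user. Then the greedy algorithm is a $(1-1/e)$-approximation algorithm: for every realization of $(R_v)_{v\in V}$ the greedy algorithm has an output, and every output $B$ satisfies $|B|\le K$ and $R_v=1$ for all $v\in B$, and $$\mathbb E|\varphi(B)|\ \ge\ \Bigl(1-\frac1e\Bigr)\,\mathbb E|\varphi(B')|\quad\text{for every } B'\subseteq V \text{ with } |B'|\le K \text{ and } R_v=1\ \ \forall v\in B'.$$ Consequently, the same inequality holds after averaging over $(R_v)_{v\in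 V}$, when $B$ and $B'$ are chosen as functions of the realization of $(R_v)_{v\in V}$, $B$ always being a greedy output and $B'$ always being feasible. -/

import Mathlib

/-- An online social network seen by one distinguished user `u₀` outside `V`.
`V` is the set of the other users, and an element of `Option V` is any user: `none` is `u₀`.
`graph.Adj u v` is the arc `u → v` along which tweets propagate (`v` follows `u`).
`prob v u S` is the probability that `v` reads and retweets the message (re)tweeted by `u`,
given that the users in `S` have already (re)tweeted it to `v` in vain. -/
structure SocialNetwork (V : Type*) where
  graph : Digraph V
  prob : V → Option V → Finset (Option V) → unitInterval

/-- The state of a cascade after some round: all active users (they have tweeted or retweeted),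
and those that became active in the last round, which are the contagious ones. -/
structure CascadeState (V : Type*) where
  active : Finset (Option V)
  contagious : Finset (Option V)

namespace SocialNetwork

variable {V : Type*} [Fintype V] [DecidableEq V] (net : SocialNetwork V)

/-- If `F` is the set of the followers of `u₀`: tweets of the first user reach the second. -/
def Reaches (F : Finset V) : Option V → V → Prop
  | none, v => v ∈ F
  | some u, v => net.graph.Adj u v

open Classical in
/-- The in-neighbours of `v` when `F` is the set of the followers of `u₀`. -/
noncomputable def inNbrs (F : Finset V) (v : V) : Finset (Option V) :=
  Finset.univ.filter fun u => net.Reaches F u v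

/-- The probability that all members of a list, making their attempts on `v` in the order of the
list after those in `S` have failed, fail too. -/
def failProb (v : V) : Finset (Option V) → List (Option V) → unitInterval
  | _, [] => 1
  | S, u :: l => unitInterval.symm (net.prob v u S) * failProb v (insert u S) l

/-- Order independence: if the users of a set attempt to influence `v` one after the other, after
those in `S` have failed, the probability that one of them succeeds does not depend on the order.
Only potential in-neighbours of `v` are concerned: those in the graph, and `u₀`. -/
def OrderIndependent : Prop :=
  ∀ (v : V) (S : Finset (Option V)) (l l' : List (Option V)),
    S ⊆ net.inNbrs Finset.univ v → l.Nodup →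
    (∀ u ∈ l, u ∈ net.inNbrs Finset.univ v ∧ u ∉ S) →
    l.Perm l' → net.failProb v S l = net.failProb v S l'

/-- Decreasing cascade: the success probability of `u` at `v` is non-increasing in the set of those
that have already attempted. -/
def DecreasingCascade : Prop :=
  ∀ (v : V) (u : Option V) (S T : Finset (Option V)),
    S ⊆ T → T ⊆ net.inNbrs Finset.univ v → u ∈ net.inNbrs Finset.univ v → u ∉ T →
    net.prob v u T ≤ net.prob v u S

/-- The users that attempt to influence `v` in the round starting from the state `s`. -/
noncomputable def attempting (F : Finset V) (s : CascadeState V) (v : V) : Finset (Option V) :=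
  net.inNbrs F v ∩ s.contagious

/-- The users that have attempted to influence `v` in the rounds leading to the state `s`. -/
noncomputable def attempted (F : Finset V) (s : CascadeState V) (v : V) : Finset (Option V) :=
  net.inNbrs F v ∩ (s.active \ s.contagious)

/-- An arbitrary rule for the order of the attempts made on each user within a round. -/
structure AttemptOrder where
  order : Finset V → CascadeState V → V → List (Option V)
  nodup : ∀ F s v, (order F s v).Nodup
  mem_iff : ∀ F s v u, u ∈ order F s v ↔ u ∈ net.attempting F s v

variable {net}

/-- The probability that `v` becomes active in the round starting from the state `s`. -/
noncomputable def activationProb (o : net.AttemptOrder) (F : Finset V) (s : CascadeState V)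
    (v : V) : unitInterval :=
  if some v ∈ s.active then 0
  else unitInterval.symm (net.failProb v (net.attempted F s v) (o.order F s v))

/-- The law of the random set that contains each `v` independently with probability `a v`. -/
noncomputable def independentSubset (a : V → unitInterval) : PMF (Finset V) :=
  PMF.ofFintype
    (fun M => ENNReal.ofReal ((∏ v ∈ M, (a v : ℝ)) * ∏ v ∈ Finset.univ \ M, (1 - (a v : ℝ))))
    (by
      rw [← ENNReal.ofReal_sum_of_nonneg]
      · have h := Finset.prod_add (fun v => (a v : ℝ)) (fun v => 1 - (a v : ℝ)) Finset.univ
        simp only [Finset.powerset_univ] at h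
        rw [← h]
        simp
      · intro M _
        exact mul_nonneg (Finset.prod_nonneg fun v _ => (a v).2.1)
          (Finset.prod_nonneg fun v _ => sub_nonneg.2 (a v).2.2))

/-- One round: the contagious users attempt to influence their inactive out-neighbours, and the
users that become active are the next contagious ones. -/
noncomputable def cascadeRound (o : net.AttemptOrder) (F : Finset V) (s : CascadeState V) :
    PMF (CascadeState V) :=
  (independentSubset (activationProb o F s)).map fun M =>
    ⟨s.active ∪ M.map Function.Embedding.some, M.map Function.Embedding.some⟩

/-- The law of the state after a number of rounds, when `u₀` tweets and `F` is the set of the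
followers of `u₀`. -/
noncomputable def cascade (o : net.AttemptOrder) (F : Finset V) : ℕ → PMF (CascadeState V)
  | 0 => PMF.pure ⟨{none}, {none}⟩
  | t + 1 => (cascade o F t).bind (cascadeRound o F)

/-- The law of the set of the users that retweet a tweet of `u₀`, when `u₀` follows the users in `B`
and `ρ v` tells whether `v` reciprocates: the followers of `u₀` are the reciprocating members
of `B`. Each round either activates a new user or is followed by no change, so the cascade is over
after `Fintype.card V` rounds. -/
noncomputable def retweeters (o : net.AttemptOrder) (ρ : V → Bool) (B : Finset V) :
    PMF (Finset V) :=
  (cascade o (B.filter fun v => ρ v = true) (Fintype.card V)).map fun s =>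
    Finset.eraseNone s.active

/-- The expected number of users that retweet a tweet of `u₀`. -/
noncomputable def expectedRetweets (o : net.AttemptOrder) (ρ : V → Bool) (B : Finset V) : ℝ :=
  ∑ A : Finset V, (retweeters o ρ B A).toReal * (A.card : ℝ)

end SocialNetwork

/-- Feasibility in the dynamic problem: at most `K` followings, all of which reciprocate. -/
def DynamicFeasible {V : Type*} (ρ : V → Bool) (K : ℕ) (B : Finset V) : Prop :=
  B.card ≤ K ∧ ∀ v ∈ B, ρ v = true

/-- `GreedyRun f ρ k B`: the greedy algorithm for the objective `f` can have selected `B` after `k`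
steps. A step adds a not yet selected reciprocating user with the largest marginal gain (ties are
broken arbitrarily), and does nothing if all reciprocating users are already selected. -/
inductive GreedyRun {V : Type*} [DecidableEq V] (f : Finset V → ℝ) (ρ : V → Bool) :
    ℕ → Finset V → Prop
  | start : GreedyRun f ρ 0 ∅
  | select {k : ℕ} {B : Finset V} {v : V} : GreedyRun f ρ k B → ρ v = true → v ∉ B →
      (∀ w, ρ w = true → w ∉ B → f (insert w B) - f B ≤ f (insert v B) - f B) →
      GreedyRun f ρ (k + 1) (insert v B)
  | idle {k : ℕ} {B : Finset V} : GreedyRun f ρ k B → (∀ w, ρ w = true → w ∈ B) →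
      GreedyRun f ρ (k + 1) B

/-! The greedy bound follows from monotonicity and submodularity of the expected number of retweets
as a function of `B`. Both are proved for a sequential cascade, in which attempts are made one at a
time. Order independence makes the choice of the next attempt irrelevant (`sequentialValue_step`),
so cascades in different networks can be run side by side on the same attempts. Since success
probabilities decrease with the number of failures, a coupling shows that a cascade that is ahead
stays ahead (`sequentialValue_le_of_dominated`).

For submodularity, take follower sets `F ⊆ G` of `u₀` and a user `w`. The attempts possible with `F`
are made in all four networks `F`, `F ∪ {w}`, `G`, `G ∪ {w}` until none is left; then those possible
with `G` are made in the last two only. What `G ∪ {w}` can still gain starts from attempts of `u₀`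
that are also available in `F ∪ {w}`, where the cascade is less advanced, so domination bounds it by
the gain there (`sequentialValue_gain_le`, `sequentialValue_submodular`).

The sequential value is a martingale along the cascade in rounds (`stateValue_eq_sum`), and after
`Fintype.card V` rounds it is the number of active users. This identifies the two models
(`expectedRetweets_eq`). -/

/-- The expected number of active users at the end of a cascade in which the attempts are made one
at a time, in an arbitrary order: `A` is the set of active users, `T v` is the set of those that
have attempted on the inactive user `v` in vain, and `N v` is the set of the in-neighbours
of `v`. -/
noncomputable def sequentialValue {V : Type*} [Fintype V] [DecidableEq V]
    (p : V → Option V → Finset (Option V) → ℝ) (N : V → Finset (Option V))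
    (A : Finset (Option V)) (T : V → Finset (Option V)) : ℝ :=
  open Classical in
  if h : ∃ e : V × Option V, some e.1 ∉ A ∧ e.2 ∉ T e.1 ∧ e.2 ∈ N e.1 ∧ e.2 ∈ A then
    p h.choose.1 h.choose.2 (T h.choose.1) *
        -- Resetting the failures at a newly active user makes the resulting state independent of
        -- the attempts that preceded the success.
        sequentialValue p N (insert (some h.choose.1) A) (Function.update T h.choose.1 ∅) +
      (1 - p h.choose.1 h.choose.2 (T h.choose.1)) *
        sequentialValue p N A
          (Function.update T h.choose.1 (insert h.choose.2 (T h.choose.1)))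
  else A.card
termination_by (Finset.univ.filter fun e : V × Option V => some e.1 ∉ A ∧ e.2 ∉ T e.1).card
decreasing_by
  all_goals
    obtain ⟨h1, h2, -, -⟩ := h.choose_spec
    apply Finset.card_lt_card
    rw [Finset.ssubset_iff_of_subset]
    · refine ⟨h.choose, by simp [h1, h2], by simp⟩
    · rintro ⟨x, y⟩ hxy
      by_cases hx : x = h.choose.1
      · subst hx
        simp_all
      · simp_all

/-! ### Sequential cascades: exchange of attempts, couplings, submodularity. -/

namespace SequentialCascade

variable {V : Type*} [Fintype V] [DecidableEq V]

/-- The induction is on the number of untried pairs at inactive users. It mentions no network, so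
one induction can serve several networks. -/
theorem state_induction {motive : Finset (Option V) → (V → Finset (Option V)) → Prop}
    (step : ∀ A T, (∀ v u, some v ∉ A → u ∉ T v →
      motive (insert (some v) A) (Function.update T v ∅) ∧
      motive A (Function.update T v (insert u (T v)))) → motive A T)
    (A : Finset (Option V)) (T : V → Finset (Option V)) : motive A T := by
  induction hn : (Finset.univ.filter fun e : V × Option V =>
    some e.1 ∉ A ∧ e.2 ∉ T e.1).card using Nat.strong_induction_on generalizing A T with
  | _ n ih =>
    refine step A T fun v u hv hu => ⟨ih _ ?_ _ _ rfl, ih _ ?_ _ _ rfl⟩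
    all_goals
      rw [← hn]
      apply Finset.card_lt_card
      rw [Finset.ssubset_iff_of_subset]
      · exact ⟨(v, u), by simp [hv, hu], by simp⟩
      · rintro ⟨x, y⟩ hxy
        by_cases hx : x = v
        · subst hx
          simp_all
        · simp_all

variable {p : V → Option V → Finset (Option V) → ℝ} {N : V → Finset (Option V)}
  {A : Finset (Option V)} {T : V → Finset (Option V)}

theorem sequentialValue_of_terminal
    (h : ∀ v u, some v ∉ A → u ∉ T v → u ∈ N v → u ∉ A) :
    sequentialValue p N A T = A.card := by
  rw [sequentialValue, dif_neg]
  rintro ⟨⟨v, u⟩, h1, h2, h3, h4⟩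
  exact h v u h1 h2 h3 h4

/-- Confluence: the attempt picked by choice is exchanged with the given one by induction. Attempts
on different users commute; those on the same user are exchanged by `hswap`. -/
theorem sequentialValue_step
    (hswap : ∀ v S u u', u ≠ u' → u ∉ S → u' ∉ S →
      (1 - p v u S) * (1 - p v u' (insert u S)) = (1 - p v u' S) * (1 - p v u (insert u' S)))
    {v : V} {u : Option V} (hv : some v ∉ A) (hT : u ∉ T v) (hN : u ∈ N v) (hA : u ∈ A) :
    sequentialValue p N A T =
      p v u (T v) * sequentialValue p N (insert (some v) A) (Function.update T v ∅) +
      (1 - p v u (T v)) *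
        sequentialValue p N A (Function.update T v (insert u (T v))) := by
  induction A, T using state_induction generalizing v u with
  | step A T ih =>
    have h : ∃ e : V × Option V, some e.1 ∉ A ∧ e.2 ∉ T e.1 ∧ e.2 ∈ N e.1 ∧ e.2 ∈ A :=
      ⟨(v, u), hv, hT, hN, hA⟩
    rw [sequentialValue, dif_pos h]
    obtain ⟨h1, h2, h3, h4⟩ := h.choose_spec
    generalize h.choose.1 = w at *
    generalize h.choose.2 = z at *
    by_cases hvw : w = v
    · subst hvw
      by_cases huz : z = u
      · rw [huz]
      · rw [(ih w z h1 h2).2 hv (by simpa using ⟨Ne.symm huz, hT⟩) hN hA,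
          (ih w u h1 hT).2 hv (by simpa using ⟨huz, h2⟩) h3 h4]
        simp only [Function.update_self, Function.update_idem, Finset.insert_comm u z]
        have := hswap w (T w) z u huz h2 hT
        -- Any success at `w` leads to the same state, so only the probability that both attempts
        -- fail matters, and `hswap` makes it symmetric.
        linear_combination (sequentialValue p N A
          (Function.update T w (insert z (insert u (T w)))) -
            sequentialValue p N (insert (some w) A) (Function.update T w ∅)) * this
    · have hwv : v ≠ w := fun h => hvw h.symm
      rw [(ih w z h1 h2).1 (v := v) (u := u) (by simp [hv, hwv]) (by simpa [hwv]) hN (by simp [hA]),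
        (ih w z h1 h2).2 (v := v) (u := u) hv (by simpa [hwv]) hN hA,
        (ih v u hv hT).1 (v := w) (u := z) (by simp [h1, hvw]) (by simpa [hvw]) h3 (by simp [h4]),
        (ih v u hv hT).2 (v := w) (u := z) h1 (by simpa [hvw]) h3 h4]
      simp only [Function.update_of_ne hwv, Function.update_of_ne hvw,
        Function.update_comm hwv, Finset.insert_comm (some v) (some w)]
      ring

theorem card_le_sequentialValue (h0 : ∀ v u S, 0 ≤ p v u S) (h1 : ∀ v u S, p v u S ≤ 1)
    (hswap : ∀ v S u u', u ≠ u' → u ∉ S → u' ∉ S →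
      (1 - p v u S) * (1 - p v u' (insert u S)) = (1 - p v u' S) * (1 - p v u (insert u' S))) :
    (A.card : ℝ) ≤ sequentialValue p N A T := by
  induction A, T using state_induction with
  | step A T ih =>
    by_cases h : ∀ v u, some v ∉ A → u ∉ T v → u ∈ N v → u ∉ A
    · rw [sequentialValue_of_terminal h]
    · push Not at h
      obtain ⟨v, u, hv, hT, hN, hA⟩ := h
      rw [sequentialValue_step hswap hv hT hN hA]
      obtain ⟨i1, i2⟩ := ih v u hv hT
      rw [Finset.card_insert_of_notMem hv] at i1
      push_cast at i1
      have a := h0 v u (T v)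
      have b := h1 v u (T v)
      nlinarith [mul_le_mul_of_nonneg_left i1 a, mul_le_mul_of_nonneg_left i2 (sub_nonneg.2 b)]

/-- A cascade with more active users or later failures at the inactive ones activates, on average,
at least as many users outside of `A'`. -/
theorem sequentialValue_le_of_dominated {N' : V → Finset (Option V)} {A' : Finset (Option V)}
    {T' : V → Finset (Option V)} (h0 : ∀ v u S, 0 ≤ p v u S) (h1 : ∀ v u S, p v u S ≤ 1)
    (hswap : ∀ v S u u', u ≠ u' → u ∉ S → u' ∉ S →
      (1 - p v u S) * (1 - p v u' (insert u S)) = (1 - p v u' S) * (1 - p v u (insert u' S)))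
    (hdecr : ∀ v u S S', S ⊆ S' → u ∉ S' → p v u S' ≤ p v u S)
    (hdom : ∀ x, some x ∉ A' → some x ∉ A → T x ⊆ T' x ∧
      ∀ u ∈ N' x, u ∉ T' x → u ∈ N x ∧ (u ∈ A' → u ∈ A)) :
    sequentialValue p N' A' T' ≤ sequentialValue p N A T + (A' \ A).card := by
  induction A', T' using state_induction generalizing A T with
  | step A' T' ih =>
    by_cases h : ∀ v u, some v ∉ A' → u ∉ T' v → u ∈ N' v → u ∉ A'
    · rw [sequentialValue_of_terminal h]
      have hA := card_le_sequentialValue (A := A) (T := T) (N := N) h0 h1 hswap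
      have : A'.card ≤ A.card + (A' \ A).card := by
        have := Finset.card_le_card_sdiff_add_card (s := A') (t := A)
        omega
      have : (A'.card : ℝ) ≤ A.card + (A' \ A).card := by exact_mod_cast this
      linarith
    · push Not at h
      obtain ⟨w, u, hw, hT, hN, hA⟩ := h
      rw [sequentialValue_step hswap hw hT hN hA]
      have p0' := h0 w u (T' w)
      have p1' := h1 w u (T' w)
      -- If `w` is already active in the dominating cascade, only the other one moves, and a success
      -- at `w` leaves `A' \ A` unchanged.
      by_cases hwA : some w ∈ A
      · have i1 := @(ih w u hw hT).1 A T (by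
          intro x hx hxA
          simp only [Finset.mem_insert, Option.some.injEq, not_or] at hx
          rw [Function.update_of_ne hx.1]
          refine ⟨(hdom x hx.2 hxA).1, fun y hy hyT => ?_⟩
          refine ⟨((hdom x hx.2 hxA).2 y hy hyT).1, fun hyA => ?_⟩
          rcases Finset.mem_insert.1 hyA with rfl | hyA
          · exact hwA
          · exact ((hdom x hx.2 hxA).2 y hy hyT).2 hyA)
        have i2 := @(ih w u hw hT).2 A T (by
          intro x hx hxA
          have hxw : x ≠ w := fun h => hxA (h ▸ hwA)
          rw [Function.update_of_ne hxw]
          exact hdom x hx hxA)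
        rw [Finset.insert_sdiff_of_mem _ hwA] at i1
        nlinarith [mul_le_mul_of_nonneg_left i1 p0',
          mul_le_mul_of_nonneg_left i2 (sub_nonneg.2 p1')]
      · obtain ⟨hTT, hd⟩ := hdom w hw hwA
        obtain ⟨hNu, hAu⟩ := hd u hN hT
        have hAu := hAu hA
        have hTu : u ∉ T w := fun h => hT (hTT h)
        rw [sequentialValue_step (N := N) hswap hwA hTu hNu hAu]
        -- Coupling of the two attempts: both succeed with probability `p w u (T' w)`, only the
        -- dominating one with the difference of the two probabilities, and otherwise both fail.
        -- `i1`, `i3` and `i2` treat these cases.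
        have pp := hdecr w u _ _ hTT hT
        have p1 := h1 w u (T w)
        have i1 := @(ih w u hw hT).1 (insert (some w) A) (Function.update T w ∅) (by
          intro x hx hxA
          simp only [Finset.mem_insert, Option.some.injEq, not_or] at hx hxA
          rw [Function.update_of_ne hx.1, Function.update_of_ne hx.1]
          obtain ⟨d1, d2⟩ := hdom x hx.2 hxA.2
          refine ⟨d1, fun y hy hyT => ⟨(d2 y hy hyT).1, fun hyA => ?_⟩⟩
          rcases Finset.mem_insert.1 hyA with rfl | hyA
          · exact Finset.mem_insert_self _ _
          · exact Finset.mem_insert_of_mem ((d2 y hy hyT).2 hyA))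
        have i2 := @(ih w u hw hT).2 A (Function.update T w (insert u (T w))) (by
          intro x hx hxA
          by_cases hxw : x = w
          · subst hxw
            simp only [Function.update_self]
            refine ⟨Finset.insert_subset_insert _ hTT, fun y hy hyT => ?_⟩
            exact hd y hy fun h => hyT (Finset.mem_insert_of_mem h)
          · rw [Function.update_of_ne hxw, Function.update_of_ne hxw]
            exact hdom x hx hxA)
        have i3 := @(ih w u hw hT).2 (insert (some w) A) (Function.update T w ∅) (by
          intro x hx hxA
          simp only [Finset.mem_insert, Option.some.injEq, not_or] at hxA
          rw [Function.update_of_ne hxA.1, Function.update_of_ne hxA.1]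
          obtain ⟨d1, d2⟩ := hdom x hx hxA.2
          exact ⟨d1, fun y hy hyT => ⟨(d2 y hy hyT).1, fun hyA =>
            Finset.mem_insert_of_mem ((d2 y hy hyT).2 hyA)⟩⟩)
        have e1 : insert (some w) A' \ insert (some w) A = A' \ A := by
          ext y
          by_cases hy : y = some w
          · simp [hy, hw]
          · simp [hy]
        have e2 : A' \ insert (some w) A = A' \ A := by
          ext y
          by_cases hy : y = some w
          · simp [hy, hw]
          · simp [hy]
        rw [e1] at i1
        rw [e2] at i3
        nlinarith [mul_le_mul_of_nonneg_left i1 p0',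
          mul_le_mul_of_nonneg_left i2 (sub_nonneg.2 p1),
          mul_le_mul_of_nonneg_left i3 (sub_nonneg.2 pp)]

theorem sequentialValue_mono {N' : V → Finset (Option V)}
    (h0 : ∀ v u S, 0 ≤ p v u S) (h1 : ∀ v u S, p v u S ≤ 1)
    (hswap : ∀ v S u u', u ≠ u' → u ∉ S → u' ∉ S →
      (1 - p v u S) * (1 - p v u' (insert u S)) = (1 - p v u' S) * (1 - p v u (insert u' S)))
    (hdecr : ∀ v u S S', S ⊆ S' → u ∉ S' → p v u S' ≤ p v u S)
    (hN : ∀ x, N x ⊆ N' x) :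
    sequentialValue p N A T ≤ sequentialValue p N' A T := by
  simpa using sequentialValue_le_of_dominated (N := N') (N' := N) (A := A) (A' := A) (T := T)
    (T' := T) h0 h1 hswap hdecr (fun x _ _ => ⟨subset_rfl, fun u hu _ => ⟨hN x hu, id⟩⟩)

/-- The failures recorded at active users play no role: each state dominates the other. -/
theorem sequentialValue_congr {T' : V → Finset (Option V)}
    (h0 : ∀ v u S, 0 ≤ p v u S) (h1 : ∀ v u S, p v u S ≤ 1)
    (hswap : ∀ v S u u', u ≠ u' → u ∉ S → u' ∉ S →
      (1 - p v u S) * (1 - p v u' (insert u S)) = (1 - p v u' S) * (1 - p v u (insert u' S)))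
    (hdecr : ∀ v u S S', S ⊆ S' → u ∉ S' → p v u S' ≤ p v u S)
    (hT : ∀ x, some x ∉ A → T x = T' x) :
    sequentialValue p N A T = sequentialValue p N A T' := by
  apply le_antisymm
  · simpa using sequentialValue_le_of_dominated (N := N) (N' := N) (A := A) (A' := A) (T := T')
      (T' := T) h0 h1 hswap hdecr
      (fun x hx _ => ⟨(hT x hx).symm.subset, fun u hu _ => ⟨hu, id⟩⟩)
  · simpa using sequentialValue_le_of_dominated (N := N) (N' := N) (A := A) (A' := A) (T := T)
      (T' := T') h0 h1 hswap hdecr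
      (fun x hx _ => ⟨(hT x hx).subset, fun u hu _ => ⟨hu, id⟩⟩)

/-- Making a further user a follower of `u₀` gains less in a more advanced cascade of a larger
network. -/
theorem sequentialValue_gain_le {N' M M' : V → Finset (Option V)} {A' : Finset (Option V)}
    {T' : V → Finset (Option V)} (h0 : ∀ v u S, 0 ≤ p v u S) (h1 : ∀ v u S, p v u S ≤ 1)
    (hswap : ∀ v S u u', u ≠ u' → u ∉ S → u' ∉ S →
      (1 - p v u S) * (1 - p v u' (insert u S)) = (1 - p v u' S) * (1 - p v u (insert u' S)))
    (hdecr : ∀ v u S S', S ⊆ S' → u ∉ S' → p v u S' ≤ p v u S)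
    (hM : ∀ x, M x ⊆ M' x) (hsome : ∀ x y, some y ∈ M' x → some y ∈ M x ∧ some y ∈ N' x)
    (hnone : ∀ x, none ∈ M' x → none ∈ M x ∨ none ∈ N' x)
    (hnA : none ∈ A) (hAA' : A ⊆ A') (hTT' : ∀ x, some x ∉ A' → T x ⊆ T' x) :
    sequentialValue p M' A' T' - sequentialValue p M A' T' ≤
      sequentialValue p N' A T - A.card := by
  induction A', T' using state_induction with
  | step A' T' ih =>
    -- Attempts possible in `M` are made in both `M` and `M'`. Once none is left, every attempt
    -- still available in `M'` comes from `u₀` and belongs to `N'`, so the cascade of `N'` from `A`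
    -- dominates.
    by_cases h : ∀ v u, some v ∉ A' → u ∉ T' v → u ∈ M v → u ∉ A'
    · rw [sequentialValue_of_terminal h]
      have key := sequentialValue_le_of_dominated (p := p) (N := N') (N' := M') (A := A)
        (A' := A') (T := T) (T' := T') h0 h1 hswap hdecr (by
          intro x hx _
          refine ⟨hTT' x hx, fun u hu huT => ?_⟩
          cases u with
          | none =>
            refine ⟨(hnone x hu).resolve_left fun hm => h x none hx huT hm (hAA' hnA),
              fun _ => hnA⟩
          | some y =>
            exact ⟨(hsome x y hu).2, fun hy => (h x _ hx huT (hsome x y hu).1 hy).elim⟩)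
      have hc : ((A' \ A).card : ℝ) = A'.card - A.card := by
        rw [Finset.card_sdiff_of_subset hAA', Nat.cast_sub (Finset.card_le_card hAA')]
      linarith
    · push Not at h
      obtain ⟨w, u, hw, hT, hN, hA⟩ := h
      rw [sequentialValue_step (N := M) hswap hw hT hN hA,
        sequentialValue_step (N := M') hswap hw hT (hM _ hN) hA]
      have i1 := (ih w u hw hT).1 (hAA'.trans (Finset.subset_insert _ _)) (by
        intro x hx
        simp only [Finset.mem_insert, Option.some.injEq, not_or] at hx
        rw [Function.update_of_ne hx.1]
        exact hTT' x hx.2)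
      have i2 := (ih w u hw hT).2 hAA' (by
        intro x hx
        by_cases hxw : x = w
        · subst hxw
          rw [Function.update_self]
          exact (hTT' x hx).trans (Finset.subset_insert _ _)
        · rw [Function.update_of_ne hxw]
          exact hTT' x hx)
      have p0 := h0 w u (T' w)
      have p1 := h1 w u (T' w)
      nlinarith [mul_le_mul_of_nonneg_left i1 p0, mul_le_mul_of_nonneg_left i2 (sub_nonneg.2 p1)]

/-- Attempts possible in the smallest network `N` are possible in all four. When they are exhausted,
the value for `N` is `A.card` and `sequentialValue_gain_le` applies. -/
theorem sequentialValue_submodular {N N' M M' : V → Finset (Option V)}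
    (h0 : ∀ v u S, 0 ≤ p v u S) (h1 : ∀ v u S, p v u S ≤ 1)
    (hswap : ∀ v S u u', u ≠ u' → u ∉ S → u' ∉ S →
      (1 - p v u S) * (1 - p v u' (insert u S)) = (1 - p v u' S) * (1 - p v u (insert u' S)))
    (hdecr : ∀ v u S S', S ⊆ S' → u ∉ S' → p v u S' ≤ p v u S)
    (hNN' : ∀ x, N x ⊆ N' x) (hNM : ∀ x, N x ⊆ M x)
    (hM : ∀ x, M x ⊆ M' x) (hsome : ∀ x y, some y ∈ M' x → some y ∈ M x ∧ some y ∈ N' x)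
    (hnone : ∀ x, none ∈ M' x → none ∈ M x ∨ none ∈ N' x) (hnA : none ∈ A) :
    sequentialValue p M' A T - sequentialValue p M A T ≤
      sequentialValue p N' A T - sequentialValue p N A T := by
  induction A, T using state_induction with
  | step A T ih =>
    by_cases h : ∀ v u, some v ∉ A → u ∉ T v → u ∈ N v → u ∉ A
    · rw [sequentialValue_of_terminal (N := N) h]
      exact sequentialValue_gain_le h0 h1 hswap hdecr hM hsome hnone hnA subset_rfl
        fun _ _ => subset_rfl
    · push Not at h
      obtain ⟨w, u, hw, hT, hN, hA⟩ := h
      rw [sequentialValue_step (N := N) hswap hw hT hN hA,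
        sequentialValue_step (N := N') hswap hw hT (hNN' _ hN) hA,
        sequentialValue_step (N := M) hswap hw hT (hNM _ hN) hA,
        sequentialValue_step (N := M') hswap hw hT (hM _ (hNM _ hN)) hA]
      obtain ⟨i1, i2⟩ := ih w u hw hT
      have i1 := i1 (Finset.mem_insert_of_mem hnA)
      have i2 := i2 hnA
      have p0 := h0 w u (T w)
      have p1 := h1 w u (T w)
      nlinarith [mul_le_mul_of_nonneg_left i1 p0, mul_le_mul_of_nonneg_left i2 (sub_nonneg.2 p1)]

end SequentialCascade

/-! ### From attempts grouped by user and round to sequential attempts. -/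

namespace SocialNetwork

variable {V : Type*} [Fintype V] {net : SocialNetwork V}

theorem mem_inNbrs {F : Finset V} {v : V} {u : Option V} :
    u ∈ net.inNbrs F v ↔ net.Reaches F u v := by
  simp [inNbrs]

theorem inNbrs_mono {F F' : Finset V} (h : F ⊆ F') (v : V) :
    net.inNbrs F v ⊆ net.inNbrs F' v := by
  intro u hu
  rw [mem_inNbrs] at *
  cases u with
  | none => exact h hu
  | some u => exact hu

variable [DecidableEq V] (net)

open Classical in
/-- The success probabilities, extended by `0` to users that are not potential in-neighbours. -/
noncomputable def attemptProb (v : V) (u : Option V) (S : Finset (Option V)) : ℝ :=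
  if u ∈ net.inNbrs Finset.univ v then (net.prob v u (S ∩ net.inNbrs Finset.univ v) : ℝ) else 0

variable {net}

theorem attemptProb_nonneg (v : V) (u : Option V) (S : Finset (Option V)) :
    0 ≤ net.attemptProb v u S := by
  unfold attemptProb
  split_ifs
  · exact unitInterval.nonneg _
  · exact le_rfl

theorem attemptProb_le_one (v : V) (u : Option V) (S : Finset (Option V)) :
    net.attemptProb v u S ≤ 1 := by
  unfold attemptProb
  split_ifs
  · exact unitInterval.le_one _
  · exact zero_le_one

/-- Two-element lists suffice. A user that is not a potential in-neighbour fails surely and does not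
affect later probabilities. -/
theorem OrderIndependent.attemptProb_swap (h : net.OrderIndependent) (v : V)
    (S : Finset (Option V)) (u u' : Option V) (huu' : u ≠ u') (hu : u ∉ S) (hu' : u' ∉ S) :
    (1 - net.attemptProb v u S) * (1 - net.attemptProb v u' (insert u S)) =
      (1 - net.attemptProb v u' S) * (1 - net.attemptProb v u (insert u' S)) := by
  by_cases h1 : u ∈ net.inNbrs Finset.univ v <;> by_cases h2 : u' ∈ net.inNbrs Finset.univ v
  · have := h v (S ∩ net.inNbrs Finset.univ v) [u, u'] [u', u] Finset.inter_subset_right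
      (by simp [huu']) (by simp [h1, h2, hu, hu']) (List.Perm.swap _ _ _)
    have := congrArg Subtype.val this
    simpa [failProb, attemptProb, h1, h2, Finset.insert_inter_of_mem] using this
  · simp [attemptProb, h1, h2, Finset.insert_inter_of_notMem]
  · simp [attemptProb, h1, h2, Finset.insert_inter_of_notMem]
  · simp [attemptProb, h1, h2]

theorem DecreasingCascade.attemptProb_le (h : net.DecreasingCascade) (v : V) (u : Option V)
    (S S' : Finset (Option V)) (hS : S ⊆ S') (hu : u ∉ S') :
    net.attemptProb v u S' ≤ net.attemptProb v u S := by
  unfold attemptProb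
  split_ifs with h1
  · exact h v u _ _ (Finset.inter_subset_inter_right hS) Finset.inter_subset_right h1
      (by simp [hu])
  · exact le_rfl

/-- The expected number of active users at the end of a cascade that has reached the active set `A`
and the sets `T v` of those that have attempted on `v` in vain. -/
noncomputable abbrev value (net : SocialNetwork V) (F : Finset V) (A : Finset (Option V))
    (T : V → Finset (Option V)) : ℝ :=
  sequentialValue net.attemptProb (net.inNbrs F) A T

/-- Iterating `sequentialValue_step` merges the attempts of a list on `v` into a single trial. -/
theorem value_eq_failProb (horder : net.OrderIndependent) {F : Finset V} {v : V}
    {A : Finset (Option V)} (hv : some v ∉ A) (l : List (Option V)) (T : V → Finset (Option V))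
    (hl : l.Nodup) (hlT : ∀ u ∈ l, u ∉ T v) (hlN : ∀ u ∈ l, u ∈ net.inNbrs F v)
    (hlA : ∀ u ∈ l, u ∈ A) (hT : T v ⊆ net.inNbrs Finset.univ v) :
    net.value F A T =
      (1 - net.failProb v (T v) l) * net.value F (insert (some v) A) (Function.update T v ∅) +
      net.failProb v (T v) l * net.value F A (Function.update T v (T v ∪ l.toFinset)) := by
  induction l generalizing T with
  | nil => simp [failProb]
  | cons u l ih =>
    have hu : u ∈ net.inNbrs Finset.univ v :=
      inNbrs_mono (Finset.subset_univ F) v (hlN u (by simp))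
    have hp : net.attemptProb v u (T v) = net.prob v u (T v) := by
      rw [attemptProb, if_pos hu, Finset.inter_eq_left.2 hT]
    rw [List.nodup_cons] at hl
    have ih := ih (Function.update T v (insert u (T v))) hl.2
      (by
        intro y hy
        rw [Function.update_self, Finset.mem_insert, not_or]
        exact ⟨fun h => hl.1 (h ▸ hy), hlT y (by simp [hy])⟩)
      (fun y hy => hlN y (by simp [hy])) (fun y hy => hlA y (by simp [hy]))
      (by
        rw [Function.update_self]
        exact Finset.insert_subset hu hT)
    simp only [Function.update_self, Function.update_idem] at ih
    rw [value, SequentialCascade.sequentialValue_step horder.attemptProb_swap hv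
      (hlT u (by simp)) (hlN u (by simp)) (hlA u (by simp)), hp]
    have e : T v ∪ (u :: l).toFinset = insert u (T v) ∪ l.toFinset := by
      ext y
      simp
    rw [e]
    simp only [value] at ih ⊢
    rw [ih]
    simp only [failProb, unitInterval.coe_symm_eq, Set.Icc.coe_mul]
    ring

/-- Simultaneous independent activations have the same value as attempts made one user at a
time. -/
theorem value_eq_sum_powerset (horder : net.OrderIndependent) (hdecr : net.DecreasingCascade)
    {F : Finset V} {A : Finset (Option V)} {T L : V → Finset (Option V)} {a : V → ℝ}
    (ha : ∀ v, some v ∈ A → a v = 0)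
    (hstep : ∀ v, some v ∉ A → ∀ A' T', A ⊆ A' → some v ∉ A' → T' v = T v →
      net.value F A' T' = a v * net.value F (insert (some v) A') (Function.update T' v ∅) +
        (1 - a v) * net.value F A' (Function.update T' v (T v ∪ L v))) (U : Finset V) :
    net.value F A T = ∑ M ∈ U.powerset, ((∏ v ∈ M, a v) * ∏ v ∈ U \ M, (1 - a v)) *
      net.value F (A ∪ M.map Function.Embedding.some)
        (fun x => if x ∈ U then T x ∪ L x else T x) := by
  have congr : ∀ {A : Finset (Option V)} {T T' : V → Finset (Option V)},
      (∀ x, some x ∉ A → T x = T' x) → net.value F A T = net.value F A T' := fun h =>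
    SequentialCascade.sequentialValue_congr attemptProb_nonneg attemptProb_le_one
      horder.attemptProb_swap hdecr.attemptProb_le h
  induction U using Finset.induction_on with
  | empty => simp
  | insert v U hvU ih =>
    rw [ih, Finset.sum_powerset_insert hvU, ← Finset.sum_add_distrib]
    refine Finset.sum_congr rfl fun M hM => ?_
    have hMU : M ⊆ U := Finset.mem_powerset.1 hM
    have hvM : v ∉ M := fun h => hvU (hMU h)
    have e1 : insert v U \ M = insert v (U \ M) := Finset.insert_sdiff_of_notMem _ hvM
    have e2 : insert v U \ insert v M = U \ M := by
      ext y
      by_cases hy : y = v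
      · simp [hy, hvU]
      · simp [hy]
    rw [e1, e2, Finset.prod_insert hvM, Finset.prod_insert (by simp [hvU])]
    by_cases hvA : some v ∈ A
    · rw [ha v hvA, congr (T' := fun x => if x ∈ insert v U then T x ∪ L x else T x)]
      · ring
      · intro x hx
        have hxv : x ≠ v := by
          rintro rfl
          exact hx (Finset.mem_union_left _ hvA)
        simp [hxv]
    -- The trial at `v` has the same probability after other users have become active: `hstep`
    -- covers every larger active set.
    · rw [hstep v hvA (A ∪ M.map Function.Embedding.some) _ Finset.subset_union_left
        (by simp [hvA, hvM]) (by simp [hvU])]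
      have e3 : Function.update (fun x => if x ∈ U then T x ∪ L x else T x) v (T v ∪ L v) =
          fun x => if x ∈ insert v U then T x ∪ L x else T x := by
        funext x
        by_cases hx : x = v
        · subst hx
          simp
        · simp [hx]
      have e4 : A ∪ (insert v M).map Function.Embedding.some =
          insert (some v) (A ∪ M.map Function.Embedding.some) := by
        rw [Finset.map_insert, Finset.union_insert]
        rfl
      rw [e3, e4, congr (A := insert (some v) (A ∪ M.map Function.Embedding.some))
        (T' := fun x => if x ∈ insert v U then T x ∪ L x else T x)]
      · ring
      · intro x hx
        have hxv : x ≠ v := by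
          rintro rfl
          exact hx (Finset.mem_insert_self _ _)
        simp [hxv]

/-! ### The martingale of the cascade in rounds and its terminal value. -/

/-- The value of a state of the cascade that proceeds in rounds. -/
noncomputable def stateValue (net : SocialNetwork V) (F : Finset V) (s : CascadeState V) : ℝ :=
  net.value F s.active (net.attempted F s)

theorem stateValue_eq_sum (horder : net.OrderIndependent) (hdecr : net.DecreasingCascade)
    (o : net.AttemptOrder) (F : Finset V) {s : CascadeState V} (hs : s.contagious ⊆ s.active) :
    net.stateValue F s = ∑ M : Finset V, ((∏ v ∈ M, (activationProb o F s v : ℝ)) *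
      ∏ v ∈ Finset.univ \ M, (1 - (activationProb o F s v : ℝ))) *
        net.stateValue F
          ⟨s.active ∪ M.map Function.Embedding.some, M.map Function.Embedding.some⟩ := by
  rw [stateValue, value_eq_sum_powerset horder hdecr (L := net.attempting F s)
    (a := fun v => (activationProb o F s v : ℝ)) _ _ Finset.univ, Finset.powerset_univ]
  · refine Finset.sum_congr rfl fun M _ => ?_
    -- A set `M` containing an active user has weight zero. Otherwise the old contagious users are
    -- exactly the ones that join those who have made their attempts.
    by_cases hM : ∃ v ∈ M, some v ∈ s.active
    · obtain ⟨v, hv, hvA⟩ := hM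
      rw [Finset.prod_eq_zero hv (by simp [activationProb, hvA])]
      simp
    · push Not at hM
      congr 1
      rw [stateValue]
      congr 1
      funext x
      ext y
      have : y ∈ s.active → y ∉ M.map Function.Embedding.some := by
        intro hy hyM
        obtain ⟨v, hv, rfl⟩ := Finset.mem_map.1 hyM
        exact hM v hv hy
      have h2 := @hs y
      simp only [attempted, attempting, Finset.mem_univ, if_true, Finset.mem_union,
        Finset.mem_inter, Finset.mem_sdiff]
      tauto
  · intro v hv
    simp [activationProb, hv]
  · intro v hv A' T' hA hvA' hT
    have ho : (o.order F s v).toFinset = net.attempting F s v := by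
      ext y
      simp [o.mem_iff]
    rw [value_eq_failProb horder hvA' (o.order F s v) T' (o.nodup F s v), hT, ho]
    · simp [activationProb, hv, unitInterval.coe_symm_eq]
    · intro u hu
      rw [o.mem_iff, attempting, Finset.mem_inter] at hu
      rw [hT, attempted]
      simp [hu.2]
    · intro u hu
      rw [o.mem_iff, attempting, Finset.mem_inter] at hu
      exact hu.1
    · intro u hu
      rw [o.mem_iff, attempting, Finset.mem_inter] at hu
      exact hA (hs hu.2)
    · rw [hT]
      exact Finset.inter_subset_left.trans (inNbrs_mono (Finset.subset_univ F) v)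

theorem stateValue_nonneg (horder : net.OrderIndependent) (F : Finset V) (s : CascadeState V) :
    0 ≤ net.stateValue F s :=
  (Nat.cast_nonneg _).trans (SequentialCascade.card_le_sequentialValue attemptProb_nonneg
    attemptProb_le_one horder.attemptProb_swap)

theorem tsum_cascadeRound (horder : net.OrderIndependent) (hdecr : net.DecreasingCascade)
    (o : net.AttemptOrder) (F : Finset V) {s : CascadeState V} (hs : s.contagious ⊆ s.active) :
    ∑' s', cascadeRound o F s s' * ENNReal.ofReal (net.stateValue F s') =
      ENNReal.ofReal (net.stateValue F s) := by
  rw [stateValue_eq_sum horder hdecr o F hs, ENNReal.ofReal_sum_of_nonneg]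
  · rw [cascadeRound]
    simp only [PMF.map_apply]
    simp_rw [← ENNReal.tsum_mul_right]
    rw [ENNReal.tsum_comm, tsum_fintype]
    refine Finset.sum_congr rfl fun M _ => ?_
    rw [tsum_eq_single ⟨s.active ∪ M.map Function.Embedding.some,
      M.map Function.Embedding.some⟩]
    · rw [if_pos rfl, ENNReal.ofReal_mul]
      · rfl
      · exact mul_nonneg (Finset.prod_nonneg fun v _ => unitInterval.nonneg _)
          (Finset.prod_nonneg fun v _ => unitInterval.one_minus_nonneg _)
    · intro s' hs'
      rw [if_neg hs', zero_mul]
  · intro M _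
    exact mul_nonneg (mul_nonneg (Finset.prod_nonneg fun v _ => unitInterval.nonneg _)
      (Finset.prod_nonneg fun v _ => unitInterval.one_minus_nonneg _))
      (stateValue_nonneg horder _ _)

/-- A round either activates someone or ends the cascade; `t + 1` counts `u₀` too. For `t =
Fintype.card V` the second alternative means that everybody is active, so the cascade is over in
both cases. -/
theorem cascade_support (o : net.AttemptOrder) (F : Finset V) (t : ℕ) {s : CascadeState V}
    (hs : s ∈ (cascade o F t).support) :
    none ∈ s.active ∧ s.contagious ⊆ s.active ∧
      (s.contagious = ∅ ∨ t + 1 ≤ s.active.card) := by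
  induction t generalizing s with
  | zero =>
    simp only [cascade, PMF.support_pure, Set.mem_singleton_iff] at hs
    subst hs
    simp
  | succ t ih =>
    simp only [cascade, PMF.mem_support_bind_iff, cascadeRound, PMF.support_map,
      Set.mem_image] at hs
    obtain ⟨s, hs, M, hM, rfl⟩ := hs
    obtain ⟨h1, h2, h3⟩ := ih hs
    refine ⟨Finset.mem_union_left _ h1, Finset.subset_union_right, ?_⟩
    by_cases hM0 : M = ∅
    · exact Or.inl (by simp [hM0])
    right
    have hprod : (∏ v ∈ M, (activationProb o F s v : ℝ)) ≠ 0 := by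
      intro h
      rw [PMF.mem_support_iff] at hM
      apply hM
      change ENNReal.ofReal _ = 0
      rw [h]
      simp
    have hact : ∀ v ∈ M, activationProb o F s v ≠ 0 := by
      intro v hv h
      exact hprod (Finset.prod_eq_zero hv (by simp [h]))
    obtain ⟨v, hv⟩ := Finset.nonempty_iff_ne_empty.2 hM0
    have hvA : some v ∉ s.active := by
      intro h
      exact hact v hv (by simp [activationProb, h])
    have hcont : s.contagious ≠ ∅ := by
      intro h
      apply hact v hv
      have : o.order F s v = [] := by
        rw [List.eq_nil_iff_forall_not_mem]
        intro u
        rw [o.mem_iff, attempting, h]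
        simp
      rw [activationProb, if_neg hvA, this, failProb]
      simp
    have h3 := h3.resolve_left hcont
    have : s.active.card < (s.active ∪ M.map Function.Embedding.some).card := by
      apply Finset.card_lt_card
      rw [Finset.ssubset_iff_of_subset Finset.subset_union_left]
      exact ⟨some v, by simp [hv], hvA⟩
    exact (Nat.succ_le_succ h3).trans this

theorem tsum_cascade (horder : net.OrderIndependent) (hdecr : net.DecreasingCascade)
    (o : net.AttemptOrder) (F : Finset V) (t : ℕ) :
    ∑' s, cascade o F t s * ENNReal.ofReal (net.stateValue F s) =
      ENNReal.ofReal (net.value F {none} fun _ => ∅) := by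
  induction t with
  | zero =>
    rw [cascade, tsum_eq_single (⟨{none}, {none}⟩ : CascadeState V)]
    · simp only [PMF.pure_apply, if_true, one_mul, stateValue]
      congr 2
      funext v
      simp [attempted]
    · intro s hs
      simp [PMF.pure_apply, hs]
  | succ t ih =>
    rw [← ih, cascade]
    simp only [PMF.bind_apply]
    simp_rw [← ENNReal.tsum_mul_right]
    rw [ENNReal.tsum_comm]
    refine tsum_congr fun s => ?_
    simp_rw [mul_assoc]
    rw [ENNReal.tsum_mul_left]
    by_cases hs : cascade o F t s = 0
    · simp [hs]
    · rw [tsum_cascadeRound horder hdecr o F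
        (cascade_support o F t ((PMF.mem_support_iff _ _).2 hs)).2.1]

/-- The value is constant in expectation and ends as the number of active users; `1` is subtracted
for `u₀`. -/
theorem expectedRetweets_eq (horder : net.OrderIndependent) (hdecr : net.DecreasingCascade)
    (o : net.AttemptOrder) (ρ : V → Bool) (B : Finset V) :
    expectedRetweets o ρ B =
      net.value (B.filter fun v => ρ v = true) {none} (fun _ => ∅) - 1 := by
  set F := B.filter fun v => ρ v = true with hF
  have hval : ∀ s ∈ (cascade o F (Fintype.card V)).support,
      net.stateValue F s = (Finset.eraseNone s.active).card + 1 := by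
    intro s hs
    obtain ⟨h1, h2, h3⟩ := cascade_support o F _ hs
    have hcard : (Finset.eraseNone s.active).card + 1 = s.active.card := by
      rw [← Finset.card_map Function.Embedding.some, Finset.map_some_eraseNone,
        Finset.card_erase_add_one h1]
    rw [stateValue, value, SequentialCascade.sequentialValue_of_terminal, ← hcard]
    · push_cast
      rfl
    · intro v u hv hu huN huA
      rcases h3 with h3 | h3
      · exact hu (by simp [attempted, h3, huN, huA])
      · have : s.active = Finset.univ :=
          Finset.eq_univ_of_card _ (le_antisymm (Finset.card_le_univ _) (by simpa using h3))
        exact hv (by simp [this])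
  have hsum : ∑' s, cascade o F (Fintype.card V) s *
      ENNReal.ofReal ((Finset.eraseNone s.active).card + 1) =
      ENNReal.ofReal (net.value F {none} fun _ => ∅) := by
    rw [← tsum_cascade horder hdecr o F (Fintype.card V)]
    refine tsum_congr fun s => ?_
    by_cases hs : cascade o F (Fintype.card V) s = 0
    · simp [hs]
    · rw [hval s ((PMF.mem_support_iff _ _).2 hs)]
  have hsum' : ∑' s, cascade o F (Fintype.card V) s * ((Finset.eraseNone s.active).card : ENNReal)
      + 1 = ENNReal.ofReal (net.value F {none} fun _ => ∅) := by
    rw [← hsum, ← (cascade o F (Fintype.card V)).tsum_coe, ← ENNReal.tsum_add]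
    refine tsum_congr fun s => ?_
    rw [ENNReal.ofReal_add (by positivity) zero_le_one, mul_add]
    simp
  have hret : ∑ A : Finset V, retweeters o ρ B A * (A.card : ENNReal) =
      ∑' s, cascade o F (Fintype.card V) s * ((Finset.eraseNone s.active).card : ENNReal) := by
    rw [retweeters, ← tsum_fintype (L := .unconditional _)]
    simp only [PMF.map_apply]
    simp_rw [← ENNReal.tsum_mul_right]
    rw [ENNReal.tsum_comm]
    refine tsum_congr fun s => ?_
    rw [tsum_eq_single (Finset.eraseNone s.active)]
    · simp [hF]
    · intro A hA
      simp [hA]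
  rw [← hret] at hsum'
  have hfin : ∀ A ∈ (Finset.univ : Finset (Finset V)),
      retweeters o ρ B A * (A.card : ENNReal) ≠ ⊤ := fun A _ =>
    ENNReal.mul_ne_top (PMF.apply_ne_top _ _) (ENNReal.natCast_ne_top _)
  have := congrArg ENNReal.toReal hsum'
  rw [ENNReal.toReal_add (ENNReal.sum_ne_top.2 hfin) ENNReal.one_ne_top,
    ENNReal.toReal_sum hfin, ENNReal.toReal_ofReal] at this
  · simp only [ENNReal.toReal_mul, ENNReal.toReal_natCast, ENNReal.toReal_one] at this
    rw [expectedRetweets]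
    linarith
  · exact (Nat.cast_nonneg _).trans (SequentialCascade.card_le_sequentialValue attemptProb_nonneg
      attemptProb_le_one horder.attemptProb_swap)

/-! ### Monotonicity and submodularity of the objective. -/

theorem expectedRetweets_nonneg (o : net.AttemptOrder) (ρ : V → Bool) (B : Finset V) :
    0 ≤ expectedRetweets o ρ B :=
  Finset.sum_nonneg fun _ _ => mul_nonneg ENNReal.toReal_nonneg (Nat.cast_nonneg _)

theorem expectedRetweets_mono (horder : net.OrderIndependent) (hdecr : net.DecreasingCascade)
    (o : net.AttemptOrder) (ρ : V → Bool) : Monotone (expectedRetweets o ρ) := by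
  intro B C h
  rw [expectedRetweets_eq horder hdecr, expectedRetweets_eq horder hdecr]
  exact sub_le_sub_right (SequentialCascade.sequentialValue_mono attemptProb_nonneg
    attemptProb_le_one horder.attemptProb_swap hdecr.attemptProb_le
    (inNbrs_mono (Finset.filter_subset_filter _ h))) _

theorem expectedRetweets_submodular (horder : net.OrderIndependent)
    (hdecr : net.DecreasingCascade) (o : net.AttemptOrder) (ρ : V → Bool) {B C : Finset V}
    (h : B ⊆ C) (w : V) :
    expectedRetweets o ρ (insert w C) - expectedRetweets o ρ C ≤
      expectedRetweets o ρ (insert w B) - expectedRetweets o ρ B := by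
  simp only [expectedRetweets_eq horder hdecr, sub_sub_sub_cancel_right]
  refine SequentialCascade.sequentialValue_submodular attemptProb_nonneg
    attemptProb_le_one horder.attemptProb_swap hdecr.attemptProb_le
    (inNbrs_mono (Finset.filter_subset_filter _ (Finset.subset_insert _ _)))
    (inNbrs_mono (Finset.filter_subset_filter _ h))
    (inNbrs_mono (Finset.filter_subset_filter _ (Finset.subset_insert _ _))) ?_ ?_ (by simp)
  · intro x y hy
    simpa [mem_inNbrs, Reaches] using hy
  · intro x hx
    simp only [mem_inNbrs, Reaches, Finset.mem_filter, Finset.mem_insert] at *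
    tauto

end SocialNetwork

/-! ### The greedy algorithm for monotone submodular functions. -/

section Greedy

variable {V : Type*} [DecidableEq V] {f : Finset V → ℝ} {ρ : V → Bool}

theorem GreedyRun.exists [Fintype V] (f : Finset V → ℝ) (ρ : V → Bool) (k : ℕ) :
    ∃ B, GreedyRun f ρ k B := by
  induction k with
  | zero => exact ⟨∅, .start⟩
  | succ k ih =>
    obtain ⟨B, hB⟩ := ih
    by_cases h : ∀ w, ρ w = true → w ∈ B
    · exact ⟨B, .idle hB h⟩
    · push Not at h
      obtain ⟨w, hw, hwB⟩ := h
      obtain ⟨v, hv, hmax⟩ := Finset.exists_max_image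
        (Finset.univ.filter fun v => ρ v = true ∧ v ∉ B) (fun v => f (insert v B) - f B)
        ⟨w, by simp [hw, hwB]⟩
      simp only [Finset.mem_filter, Finset.mem_univ, true_and] at hv hmax
      exact ⟨insert v B, .select hB hv.1 hv.2 fun w h1 h2 => hmax w ⟨h1, h2⟩⟩

theorem GreedyRun.feasible {k : ℕ} {B : Finset V} (h : GreedyRun f ρ k B) :
    DynamicFeasible ρ k B := by
  induction h with
  | start => exact ⟨by simp, by simp⟩
  | @select k B v _ hv hvB _ ih =>
    refine ⟨by rw [Finset.card_insert_of_notMem hvB]; exact Nat.succ_le_succ ih.1, ?_⟩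
    intro w hw
    rcases Finset.mem_insert.1 hw with rfl | hw
    · exact hv
    · exact ih.2 w hw
  | idle _ _ ih => exact ⟨ih.1.trans (Nat.le_succ _), ih.2⟩

theorem union_sub_le_sum_of_submodular
    (hsub : ∀ B C : Finset V, B ⊆ C → ∀ w, f (insert w C) - f C ≤ f (insert w B) - f B)
    (B C : Finset V) : f (B ∪ C) - f B ≤ ∑ w ∈ C, (f (insert w B) - f B) := by
  induction C using Finset.induction_on with
  | empty => simp
  | insert w C hw ih =>
    rw [Finset.sum_insert hw, Finset.union_insert]
    linarith [hsub B (B ∪ C) Finset.subset_union_left w]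

/-- By submodularity, the gap to `B'` is at most the sum of at most `K` marginal gains, none above
the greedy one. Hence a selection closes at least the fraction `1 / K` of the gap. -/
theorem GreedyRun.gap_le (hmono : Monotone f)
    (hsub : ∀ B C : Finset V, B ⊆ C → ∀ w, f (insert w C) - f C ≤ f (insert w B) - f B)
    {K : ℕ} (hK : 0 < K) {B' : Finset V} (hB' : DynamicFeasible ρ K B')
    {k : ℕ} {B : Finset V} (h : GreedyRun f ρ k B) :
    f B' - f B ≤ (1 - 1 / (K : ℝ)) ^ k * (f B' - f ∅) := by
  have hK1 : (1 : ℝ) ≤ K := by exact_mod_cast hK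
  have hfac : (0 : ℝ) ≤ 1 - 1 / K := by
    rw [sub_nonneg, div_le_one (by linarith)]
    exact hK1
  induction h with
  | start => simp
  | @select k B v _ hv hvB hmax ih =>
    have hv0 : 0 ≤ f (insert v B) - f B := sub_nonneg.2 (hmono (Finset.subset_insert _ _))
    have h1 : f B' - f B ≤ K * (f (insert v B) - f B) :=
      calc f B' - f B ≤ f (B ∪ B') - f B := sub_le_sub_right (hmono Finset.subset_union_right) _
        _ ≤ ∑ w ∈ B', (f (insert w B) - f B) := union_sub_le_sum_of_submodular hsub B B'
        _ ≤ ∑ _w ∈ B', (f (insert v B) - f B) := by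
          refine Finset.sum_le_sum fun w hw => ?_
          by_cases hwB : w ∈ B
          · rw [Finset.insert_eq_of_mem hwB, sub_self]
            exact hv0
          · exact hmax w (hB'.2 w hw) hwB
        _ = B'.card * (f (insert v B) - f B) := by rw [Finset.sum_const, nsmul_eq_mul]
        _ ≤ K * (f (insert v B) - f B) :=
          mul_le_mul_of_nonneg_right (by exact_mod_cast hB'.1) hv0
    have h2 : (f B' - f B) / K ≤ f (insert v B) - f B := by
      rw [div_le_iff₀ (by linarith)]
      linarith
    calc f B' - f (insert v B) ≤ (1 - 1 / (K : ℝ)) * (f B' - f B) := by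
          rw [sub_mul, one_mul, one_div_mul_eq_div]
          linarith
      _ ≤ (1 - 1 / (K : ℝ)) * ((1 - 1 / (K : ℝ)) ^ k * (f B' - f ∅)) :=
          mul_le_mul_of_nonneg_left ih hfac
      _ = _ := by rw [pow_succ]; ring
  -- All reciprocating users are selected, so `B'` is contained in `B` and the gap is nonpositive.
  | @idle k B _ hall _ =>
    have h1 : f B' ≤ f B := hmono fun w hw => hall w (hB'.2 w hw)
    have h2 : 0 ≤ f B' - f ∅ := sub_nonneg.2 (hmono (Finset.empty_subset _))
    have := mul_nonneg (pow_nonneg hfac (k + 1)) h2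
    linarith

/-- The greedy algorithm is a `(1 - 1/e)`-approximation for monotone submodular functions. -/
theorem GreedyRun.approximation (hmono : Monotone f)
    (hsub : ∀ B C : Finset V, B ⊆ C → ∀ w, f (insert w C) - f C ≤ f (insert w B) - f B)
    (h0 : 0 ≤ f ∅) {K : ℕ} {B B' : Finset V} (h : GreedyRun f ρ K B)
    (hB' : DynamicFeasible ρ K B') : (1 - 1 / Real.exp 1) * f B' ≤ f B := by
  have hB'0 : f ∅ ≤ f B' := hmono (Finset.empty_subset _)
  have he : 0 < 1 / Real.exp 1 := by positivity
  -- For `K = 0` the power is `1`, which is not below `1 / e`; but then `B'` is empty.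
  rcases Nat.eq_zero_or_pos K with rfl | hK
  · have : B' = ∅ := by simpa using hB'.1
    subst this
    have := hmono (Finset.empty_subset B)
    have := mul_nonneg he.le h0
    linarith
  · have hgap := h.gap_le hmono hsub hK hB'
    have hpow : (1 - 1 / (K : ℝ)) ^ K ≤ 1 / Real.exp 1 := by
      rw [one_div (Real.exp 1), ← Real.exp_neg]
      exact Real.one_sub_div_pow_le_exp_neg (by exact_mod_cast hK)
    have := mul_le_mul_of_nonneg_right hpow (sub_nonneg.2 hB'0)
    have := mul_nonneg he.le h0
    linarith

end Greedy

/-! ### The approximation for each realization and on average. -/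

theorem proposition2 {V : Type*} [Fintype V] [DecidableEq V] (net : SocialNetwork V)
    (horder : net.OrderIndependent) (hdecr : net.DecreasingCascade) (o : net.AttemptOrder)
    {Ω : Type*} [MeasurableSpace Ω] (P : MeasureTheory.Measure Ω)
    [MeasureTheory.IsProbabilityMeasure P]
    (R : Ω → V → Bool) (hR : ∀ v, Measurable fun ω => R ω v) (K : ℕ) :
    -- for each realization of the reciprocations, every run of the greedy algorithm
    (∀ ω : Ω,
      (∃ B, GreedyRun (SocialNetwork.expectedRetweets o (R ω)) (R ω) K B) ∧
      ∀ B, GreedyRun (SocialNetwork.expectedRetweets o (R ω)) (R ω) K B →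
        DynamicFeasible (R ω) K B ∧
        ∀ B', DynamicFeasible (R ω) K B' →
          (1 - 1 / Real.exp 1) * SocialNetwork.expectedRetweets o (R ω) B' ≤
            SocialNetwork.expectedRetweets o (R ω) B) ∧
    -- hence on average over the reciprocations, against every selection rule
    ∀ g b : (V → Bool) → Finset V,
      (∀ ρ, GreedyRun (SocialNetwork.expectedRetweets o ρ) ρ K (g ρ)) →
      (∀ ρ, DynamicFeasible ρ K (b ρ)) →
      (1 - 1 / Real.exp 1) * ∫ ω, SocialNetwork.expectedRetweets o (R ω) (b (R ω)) ∂P ≤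
        ∫ ω, SocialNetwork.expectedRetweets o (R ω) (g (R ω)) ∂P := by
  have approx : ∀ (ρ : V → Bool) (B B' : Finset V),
      GreedyRun (SocialNetwork.expectedRetweets o ρ) ρ K B → DynamicFeasible ρ K B' →
      (1 - 1 / Real.exp 1) * SocialNetwork.expectedRetweets o ρ B' ≤
        SocialNetwork.expectedRetweets o ρ B := fun ρ B B' hB hB' =>
    hB.approximation (SocialNetwork.expectedRetweets_mono horder hdecr o ρ)
      (fun _ _ h w => SocialNetwork.expectedRetweets_submodular horder hdecr o ρ h w)
      (SocialNetwork.expectedRetweets_nonneg o ρ ∅) hB'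
  refine ⟨fun ω => ⟨GreedyRun.exists _ _ K, fun B hB => ⟨hB.feasible, fun B' hB' =>
    approx _ _ _ hB hB'⟩⟩, fun g b hg hb => ?_⟩
  have hRm : Measurable R := measurable_pi_iff.2 hR
  have hint : ∀ c : (V → Bool) → Finset V, MeasureTheory.Integrable
      (fun ω => SocialNetwork.expectedRetweets o (R ω) (c (R ω))) P := fun c =>
    -- There are finitely many reciprocation patterns, so every selection rule gives an integrable
    -- function of the pattern under the law of `R`.
    (MeasureTheory.Integrable.of_finite (μ := P.map R)
      (f := fun ρ => SocialNetwork.expectedRetweets o ρ (c ρ))).comp_measurable hRm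
  rw [← MeasureTheory.integral_const_mul]
  exact MeasureTheory.integral_mono ((hint b).const_mul _) (hint g) fun ω =>
    approx _ _ _ (hg _) (hb _)
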